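/- Let $B_r^n\subseteq\mathbb R^n$ be the closed Euclidean ball of radius $r$ centred at the origin and $\nu_n=\operatorname{vol}(B_1^n)$. Let $\xi=1.79556\ldots$ be the unique positive real root of $\ln(2x/\mathrm e)=1/(2x)$. For a lattice $\Lambda\subseteq\mathbb R^n$ (the integer span of a basis of $\mathbb R^n$), the torus $\mathbb T=\mathbb R^n/\Lambda$, equipped with the Lebesgue measure of a fundamental domain of $\Lambda$, is called a packing torus of $B_2^n$ if the translates $B_2^n+p$, $p\in\Lambda$, are pairwise disjoint. Subsets of $\mathbb R^n$ are identified with their projections to $\mathbb T$. A random set $X\subseteq\mathbb T$ is sampled from the Poisson point process with intensity $\rho$ if, for every measurable $S\subseteq\mathbb T$, $|X\cap S|$ has the Poisson distribution with mean $\rho\operatorname{vol}(S)$, and, for disjoint measurable $S_1,\dots,S_k\subseteq\mathbb T$, the variables $|X\cap S_1|,\dots,|X\cap S_k|$ are mutually independent. **Theorem.** Let $0<\delta<1$ and $M>0$ be constants. Suppose that $\mathbb T$ is a packing torus of $B_2^n$ with $\operatorname{vol}(\mathbb T)\le M^n\nu_n$, and that $X$ is sampled from the Poisson point process on $\mathbb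 T$ with intensity $\rho=\left(\frac12+\delta\right)\frac{n\ln n}{\nu_n}$. Then the probability that all of the following hold tends to $1$ as $n\to\infty$, uniformly over all such $\mathbb T$ and $X$ (that is, for every $\varepsilon>0$ there is $n_0$ depending only on $\delta,M,\varepsilon$ such that the probability is at least $1-\varepsilon$ for all $n\ge n_0$ and all such $\mathbb T$ and $X$): 1. $\mathbb T\subseteq X+B_1^n$; 2. the covering density $\sum_{x\in X}\operatorname{vol}\big(\mathbb T\cap (B_1^n+x)\big)/\operatorname{vol}(\mathbb T)$ is at most $\left(\frac12+2\delta\right)n\ln n$; 3. the covering multiplicity $\sup_{u\in\mathbb T}\big|\{x\in X: u\in B_1^n+x\}\big|$ is at most $(\xi+10\delta)\,n\ln n$. -/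

import Mathlib

open MeasureTheory ProbabilityTheory Filter
open scoped NNReal ENNReal Pointwise

noncomputable section

namespace PoissonCovering

/-- The Euclidean space `ℝⁿ`. -/
abbrev Space (n : ℕ) : Type := EuclideanSpace ℝ (Fin n)

/-- `ν_n`, the volume of the closed unit ball of `ℝⁿ`. -/
def unitBallVolume (n : ℕ) : ℝ≥0∞ := volume (Metric.closedBall (0 : Space n) 1)

/-- The lattice of all integer combinations of the basis vectors `b 0, …, b (n - 1)`. -/
def lattice {n : ℕ} (b : Module.Basis (Fin n) ℝ (Space n)) : AddSubgroup (Space n) :=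
  (Submodule.span ℤ (Set.range b)).toAddSubgroup

/-- A lattice packs `K` if its distinct elements give disjoint translates of `K`. -/
def IsPackingLattice {n : ℕ} (K : Set (Space n)) (Λ : AddSubgroup (Space n)) : Prop :=
  ∀ p ∈ Λ, ∀ q ∈ Λ, p ≠ q → Disjoint (p +ᵥ K) (q +ᵥ K)

/-- The torus `ℝⁿ / Λ`, for the lattice `Λ` generated by `b`; it carries the quotient topology and
the quotient (equivalently, Borel) σ-algebra. -/
abbrev Torus {n : ℕ} (b : Module.Basis (Fin n) ℝ (Space n)) : Type := Space n ⧸ lattice b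

/-- The projection of a subset of `ℝⁿ` to the torus. -/
def proj {n : ℕ} (b : Module.Basis (Fin n) ℝ (Space n)) (A : Set (Space n)) : Set (Torus b) :=
  (QuotientAddGroup.mk : Space n → Torus b) '' A

/-- The volume on the torus: Lebesgue measure on the fundamental domain
`{∑ i, t i • b i | 0 ≤ t i < 1}`, transported to the torus by the projection. -/
def torusVolume {n : ℕ} (b : Module.Basis (Fin n) ℝ (Space n)) : Measure (Torus b) :=
  (volume.restrict (ZSpan.fundamentalDomain b)).map
    (QuotientAddGroup.mk : Space n → Torus b)

section Covering

variable {G : Type*} [AddCommGroup G]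

/-- The density `∑_{p ∈ P} vol (A ∩ (K + p)) / vol A` of `P` over `A`, with respect to `K`. -/
def coveringDensity [MeasurableSpace G] (vol : Measure G) (K P A : Set G) : ℝ≥0∞ :=
  ∑' p : P, vol (A ∩ ((p : G) +ᵥ K)) / vol A

/-- The number of `p ∈ P` such that `x ∈ K + p`. -/
def multiplicityAt (K P : Set G) (x : G) : ℕ∞ := {p ∈ P | x ∈ p +ᵥ K}.encard

/-- The supremum over `x ∈ A` of the number of `p ∈ P` such that `x ∈ K + p`. -/
def coveringMultiplicity (K P A : Set G) : ℕ∞ := ⨆ x ∈ A, multiplicityAt K P x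

end Covering

/-- The random set `X ⊆ ℝⁿ / Λ` is sampled from the Poisson point process with intensity `ρ`:
the number of points in a measurable set `S` is Poisson distributed with mean `ρ * vol S`, and the
numbers of points in finitely many disjoint measurable sets are mutually independent. (Every subset
of the torus is bounded and has finite volume.) -/
structure IsPoissonProcess {n : ℕ} (b : Module.Basis (Fin n) ℝ (Space n))
    {Ω : Type*} [MeasurableSpace Ω] (P : Measure Ω) (X : Ω → Set (Torus b)) (ρ : ℝ≥0) : Prop where
  law : ∀ S : Set (Torus b), MeasurableSet S →
    HasLaw (fun ω => (X ω ∩ S).encard)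
      ((poissonMeasure (ρ * (torusVolume b S).toNNReal)).map (Nat.cast : ℕ → ℕ∞)) P
  indep : ∀ (k : ℕ) (S : Fin k → Set (Torus b)), (∀ i, MeasurableSet (S i)) →
    Pairwise (Function.onFun Disjoint S) →
    iIndepFun (fun i ω => (X ω ∩ S i).encard) P

end PoissonCovering

end

/-!
# Poisson coverings of a packing torus

Write `L = n * log n`; a unit ball of the torus contains `(1 / 2 + δ) * L` points of `X` on average.
A net fine enough to pass from net points to all points by shrinking the radius has about `n ^ n`
points, which is too many for a union bound over empty balls. The way out is to use two nets. The
coarse one has mesh `η = n ^ (-(1 / 2 + δ / 4))`, hence at most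
`(2 * M / η) ^ n = n ^ ((1 / 2 + δ / 4 + o(1)) * n)` points (`exists_finset_net`), and the fine one
has mesh `τ = n ^ (-2)`.

If the unit ball around `u` misses `X`, then the unit ball around a coarse net point `v` near `u`
is nearly empty: its points lie in the crescent between the two balls, which is contained in a
slightly larger crescent centred at net points. For `|u - v|` at most about `η`, which is
`o(n ^ (-1 / 2))`, a crescent has a vanishing share of the volume of the unit ball
(`volume_closedBall_diff_closedBall_le`, `eventually_volume_closedBall_diff_closedBall_le`), so that
the probability that one of the `n ^ O(n)` crescents contains `c * L` points is `n ^ (-C * n)` with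
`C` as large as desired, for every constant `c > 0`. A coarse ball has at most `c * L` points with
probability at most `n ^ (-(1 / 2 + δ / 2) * n)`, which beats the size of the coarse net. Hence
every `u` is covered (`univ_subset_add_proj_closedBall`).

The same comparison bounds the multiplicity by the largest count in a coarse ball plus `c * L`
(`coveringMultiplicity_le`). The counts in coarse balls stay below three times their mean, and
`3 * (1 / 2 + δ) + c ≤ ξ + 10 * δ`. The density is `|X| * ν_n / vol 𝕋` (`coveringDensity_eq`), a
multiple of a Poisson variable of large mean. All probabilities are estimated by Chernoff bounds
and the events are put together in `measure_compl_le_of_isPoissonProcess`.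
-/

/-! ### The constant `ξ` -/

theorem existsUnique_root_log_eq :
    ∃ ξ : ℝ, 1.79556 ≤ ξ ∧ ξ < 1.79557 ∧
      ∀ x : ℝ, 0 < x → (Real.log (2 * x / Real.exp 1) = 1 / (2 * x) ↔ x = ξ) := by
  have hlog : ∀ x : ℝ, 0 < x → Real.log (2 * x / Real.exp 1) = Real.log (2 * x) - 1 := by
    intro x hx
    rw [Real.log_div (by positivity) (by positivity), Real.log_exp]
  let f : ℝ → ℝ := fun x => Real.log (2 * x / Real.exp 1) - 1 / (2 * x)
  have hmono : StrictMonoOn f (Set.Ioi 0) := by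
    intro x hx y hy hxy
    have hx' : 0 < x := hx
    have h1 : Real.log (2 * x / Real.exp 1) < Real.log (2 * y / Real.exp 1) := by
      apply Real.log_lt_log (by positivity)
      gcongr
    have h2 : 1 / (2 * y) < 1 / (2 * x) := by gcongr
    simp only [f]
    linarith
  -- `3.5911… = 4 (1 - t)` with `t ≈ 0.1022`, so both logarithms come from `log 2` and the
  -- Taylor series of `log (1 - t)`.
  have hlo : f 1.79556 ≤ 0 := by
    simp only [f]
    rw [hlog _ (by norm_num)]
    have e : (2 * 1.79556 : ℝ) = 2 ^ 2 * (1 - 0.10222) := by norm_num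
    have h1 := abs_le.1 (Real.abs_log_sub_add_sum_range_le (x := 0.10222)
      (by rw [abs_of_pos] <;> norm_num) 9)
    rw [abs_of_pos (by norm_num)] at h1
    have h2 := Real.log_two_lt_d9
    have h4 := h1.2
    norm_num [Finset.sum_range_succ] at h4
    rw [e, Real.log_mul (by norm_num) (by norm_num), Real.log_pow]
    norm_num
    linarith
  have hhi : 0 < f 1.79557 := by
    simp only [f]
    rw [hlog _ (by norm_num)]
    have e : (2 * 1.79557 : ℝ) = 2 ^ 2 * (1 - 0.102215) := by norm_num
    have h1 := abs_le.1 (Real.abs_log_sub_add_sum_range_le (x := 0.102215)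
      (by rw [abs_of_pos] <;> norm_num) 9)
    rw [abs_of_pos (by norm_num)] at h1
    have h2 := Real.log_two_gt_d9
    have h4 := h1.1
    norm_num [Finset.sum_range_succ] at h4
    rw [e, Real.log_mul (by norm_num) (by norm_num), Real.log_pow]
    norm_num
    linarith
  have hcont : ContinuousOn f (Set.Icc 1.79556 1.79557) := by
    intro x hx
    have hx0 : (0 : ℝ) < x := lt_of_lt_of_le (by norm_num) hx.1
    have : 2 * x / Real.exp 1 ≠ 0 := by positivity
    have : 2 * x ≠ 0 := by positivity
    apply ContinuousAt.continuousWithinAt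
    simp only [f]
    fun_prop (disch := assumption)
  obtain ⟨ξ, ⟨h1, h2⟩, h3⟩ := intermediate_value_Icc (by norm_num) hcont
    (show (0 : ℝ) ∈ Set.Icc _ _ from ⟨hlo, hhi.le⟩)
  have hξ0 : (0 : ℝ) < ξ := lt_of_lt_of_le (by norm_num) h1
  refine ⟨ξ, h1, lt_of_le_of_ne h2 ?_, fun x hx => ⟨fun h => ?_, fun h => ?_⟩⟩
  · rintro rfl
    exact hhi.ne' h3
  · apply hmono.injOn hx hξ0
    rw [h3]
    simp only [f]
    linarith
  · subst h
    simp only [f] at h3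
    linarith

/-! ### Chernoff bounds for the Poisson distribution -/

/-- The probability generating function of the Poisson distribution. -/
theorem lintegral_pow_poissonMeasure (r : ℝ≥0) {t : ℝ} (ht : 0 ≤ t) :
    ∫⁻ k, ENNReal.ofReal (t ^ k) ∂(poissonMeasure r) =
      ENNReal.ofReal (Real.exp (r * (t - 1))) := by
  rw [poissonMeasure, lintegral_sum_measure]
  have hs : HasSum (fun k : ℕ => Real.exp (-r) * (r * t) ^ k / (k.factorial : ℝ))
      (Real.exp (r * (t - 1))) := by
    convert! (NormedSpace.expSeries_div_hasSum_exp ((r : ℝ) * t)).mul_left (Real.exp (-r)) using 1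
    · simp_rw [mul_div_assoc]
    · rw [← Real.exp_eq_exp_ℝ, ← Real.exp_add]
      congr 1
      ring
  rw [← hs.tsum_eq, ENNReal.ofReal_tsum_of_nonneg (fun k => by positivity) hs.summable]
  congr 1
  ext k
  rw [lintegral_smul_measure, lintegral_dirac, smul_eq_mul,
    ← ENNReal.ofReal_mul (by positivity)]
  congr 1
  rw [mul_pow]
  ring

/-- Markov's inequality for `t ^ N`, with `N` Poisson; the hypothesis `hS` holds for upper
tails when `1 ≤ t` and for lower tails when `t ≤ 1`. -/
theorem poissonMeasure_le_of_rpow_le (r : ℝ≥0) {t a : ℝ} (ht : 0 < t) {S : Set ℕ}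
    (hS : ∀ k ∈ S, t ^ a ≤ t ^ k) :
    poissonMeasure r S ≤ ENNReal.ofReal (Real.exp (r * (t - 1) - a * Real.log t)) := by
  have hta : 0 < t ^ a := Real.rpow_pos_of_pos ht a
  calc poissonMeasure r S
      ≤ poissonMeasure r {k | ENNReal.ofReal (t ^ a) ≤ ENNReal.ofReal (t ^ k)} :=
        measure_mono fun k hk => ENNReal.ofReal_le_ofReal (hS k hk)
    _ ≤ (∫⁻ k, ENNReal.ofReal (t ^ k) ∂(poissonMeasure r)) / ENNReal.ofReal (t ^ a) :=
        meas_ge_le_lintegral_div (Measurable.of_discrete).aemeasurable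
          (by simpa using hta) ENNReal.ofReal_ne_top
    _ = _ := by
        rw [lintegral_pow_poissonMeasure r ht.le, ← ENNReal.ofReal_div_of_pos hta,
          Real.rpow_def_of_pos ht, ← Real.exp_sub]
        congr 3
        ring

section Tail

variable {Ω : Type*} [MeasurableSpace Ω] {P : Measure Ω} {N : Ω → ℕ∞} {r : ℝ≥0}

theorem measure_eq_poissonMeasure
    (hN : HasLaw N ((poissonMeasure r).map (Nat.cast : ℕ → ℕ∞)) P) (p : ℕ∞ → Prop) :
    P {ω | p (N ω)} = poissonMeasure r {k | p k} := by
  rw [hN.measure_eq (MeasurableSet.of_discrete (s := {x | p x})),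
    Measure.map_apply Measurable.of_discrete .of_discrete]
  rfl

theorem measure_ge_le_of_hasLaw_poisson
    (hN : HasLaw N ((poissonMeasure r).map (Nat.cast : ℕ → ℕ∞)) P) {t : ℝ} (ht : 1 ≤ t) (a : ℝ) :
    P {ω | ENNReal.ofReal a ≤ (N ω : ℝ≥0∞)} ≤
      ENNReal.ofReal (Real.exp (r * (t - 1) - a * Real.log t)) := by
  rw [measure_eq_poissonMeasure hN fun k => ENNReal.ofReal a ≤ (k : ℝ≥0∞)]
  refine poissonMeasure_le_of_rpow_le r (by linarith) fun k hk => ?_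
  rw [← Real.rpow_natCast]
  apply Real.rpow_le_rpow_of_exponent_le ht
  have : ENNReal.ofReal a ≤ (k : ℝ≥0∞) := by simpa using hk
  rwa [← ENNReal.ofReal_natCast, ENNReal.ofReal_le_ofReal_iff (by positivity)] at this

theorem measure_le_le_of_hasLaw_poisson
    (hN : HasLaw N ((poissonMeasure r).map (Nat.cast : ℕ → ℕ∞)) P) {t : ℝ} (ht0 : 0 < t)
    (ht : t ≤ 1) {a : ℝ} (ha : 0 ≤ a) :
    P {ω | (N ω : ℝ≥0∞) ≤ ENNReal.ofReal a} ≤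
      ENNReal.ofReal (Real.exp (r * (t - 1) - a * Real.log t)) := by
  rw [measure_eq_poissonMeasure hN fun k => (k : ℝ≥0∞) ≤ ENNReal.ofReal a]
  refine poissonMeasure_le_of_rpow_le r ht0 fun k hk => ?_
  rw [← Real.rpow_natCast]
  apply Real.rpow_le_rpow_of_exponent_ge ht0 ht
  have : (k : ℝ≥0∞) ≤ ENNReal.ofReal a := by simpa using hk
  rwa [← ENNReal.ofReal_natCast, ENNReal.ofReal_le_ofReal_iff ha] at this

end Tail

/-! ### The volume of a crescent -/

section Crescent

open Metric

variable {n : ℕ}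

/-- A reflection carries `v` to `w` and preserves the ball. -/
theorem lintegral_sq_inner_eq_of_norm_eq {v w : EuclideanSpace ℝ (Fin n)} (h : ‖v‖ = ‖w‖)
    (r : ℝ) :
    ∫⁻ y in closedBall (0 : EuclideanSpace ℝ (Fin n)) r, ENNReal.ofReal (inner ℝ v y ^ 2) =
      ∫⁻ y in closedBall (0 : EuclideanSpace ℝ (Fin n)) r, ENNReal.ofReal (inner ℝ w y ^ 2) := by
  let R := (ℝ ∙ (v - w))ᗮ.reflection
  have hR : R v = w := Submodule.reflection_sub h
  have hmp : MeasurePreserving R volume volume := LinearIsometryEquiv.measurePreserving R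
  have hpre : R ⁻¹' closedBall 0 r = closedBall 0 r := by
    ext y; simp
  have := hmp.setLIntegral_comp_preimage (s := closedBall 0 r)
    isClosed_closedBall.measurableSet
    (f := fun y => ENNReal.ofReal (inner ℝ w y ^ 2)) (by fun_prop)
  rw [← this, hpre]
  refine lintegral_congr fun y => ?_
  rw [← hR, LinearIsometryEquiv.inner_map_map]

/-- The second moment of the uniform distribution on the unit ball, in any direction, is at most
`1 / n`: by symmetry it does not depend on the direction, and over an orthonormal basis the second
moments add up to at most `1`. -/
theorem lintegral_sq_inner_unitBall_le (w : EuclideanSpace ℝ (Fin n)) :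
    n * ∫⁻ y in closedBall (0 : EuclideanSpace ℝ (Fin n)) 1, ENNReal.ofReal (inner ℝ w y ^ 2) ≤
      ENNReal.ofReal (‖w‖ ^ 2) * volume (closedBall (0 : EuclideanSpace ℝ (Fin n)) 1) := by
  have h1 : ∀ i : Fin n,
      ∫⁻ y in closedBall (0 : EuclideanSpace ℝ (Fin n)) 1, ENNReal.ofReal (inner ℝ w y ^ 2) =
      ∫⁻ y in closedBall (0 : EuclideanSpace ℝ (Fin n)) 1,
        ENNReal.ofReal (‖w‖ ^ 2 * y i ^ 2) := by
    intro i
    rw [lintegral_sq_inner_eq_of_norm_eq (w := ‖w‖ • EuclideanSpace.single i (1 : ℝ))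
      (by simp [norm_smul])]
    simp [inner_smul_left, EuclideanSpace.inner_single_left, mul_pow]
  calc (n : ℝ≥0∞) * ∫⁻ y in closedBall (0 : EuclideanSpace ℝ (Fin n)) 1,
        ENNReal.ofReal (inner ℝ w y ^ 2)
      = ∑ i : Fin n, ∫⁻ y in closedBall (0 : EuclideanSpace ℝ (Fin n)) 1,
          ENNReal.ofReal (‖w‖ ^ 2 * y i ^ 2) := by
        rw [← Finset.sum_congr rfl fun i _ => h1 i]
        simp
    _ = ∫⁻ y in closedBall (0 : EuclideanSpace ℝ (Fin n)) 1,
          ENNReal.ofReal (‖w‖ ^ 2 * ‖y‖ ^ 2) := by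
        rw [← lintegral_finsetSum _ (fun i _ => by fun_prop)]
        refine lintegral_congr fun y => ?_
        rw [← ENNReal.ofReal_sum_of_nonneg (fun i _ => by positivity), EuclideanSpace.norm_sq_eq y,
          Finset.mul_sum]
        simp
    _ ≤ ∫⁻ y in closedBall (0 : EuclideanSpace ℝ (Fin n)) 1, ENNReal.ofReal (‖w‖ ^ 2) := by
        refine setLIntegral_mono measurable_const fun y hy => ENNReal.ofReal_le_ofReal ?_
        have : ‖y‖ ≤ 1 := by simpa using hy
        have h2 : ‖y‖ ^ 2 ≤ 1 := pow_le_one₀ (norm_nonneg _) this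
        nlinarith [sq_nonneg ‖w‖]
    _ = _ := by simp

/-- A point `p + y` of the crescent either lies in the thin shell `1 - σ < ‖y‖ ≤ 1 + τ`, or `y` has
an inner product of size at least `σ / 2` with `q - p`, which Chebyshev's inequality makes rare. -/
theorem volume_closedBall_diff_closedBall_le (p q : EuclideanSpace ℝ (Fin n)) {τ σ ω : ℝ}
    (hτ : 0 ≤ τ) (hτ1 : τ ≤ 1) (hσ : 0 < σ) (hσ1 : σ ≤ 1) (hn : 0 < n) (hpq : dist p q ≤ ω)
    (h : (1 - σ) ^ 2 + ω ^ 2 + σ ≤ (1 - τ) ^ 2) :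
    volume (closedBall p (1 + τ) \ closedBall q (1 - τ)) ≤
      ENNReal.ofReal ((1 + τ) ^ n - (1 - σ) ^ n + 4 * ω ^ 2 / (n * σ ^ 2)) *
        volume (closedBall (0 : EuclideanSpace ℝ (Fin n)) 1) := by
  set ν := volume (closedBall (0 : EuclideanSpace ℝ (Fin n)) 1) with hν
  have hνtop : ν ≠ ⊤ := measure_closedBall_lt_top.ne
  have hω : 0 ≤ ω := dist_nonneg.trans hpq
  let w := q - p
  have hw : ‖w‖ ≤ ω := by rwa [dist_comm, dist_eq_norm] at hpq
  have hn' : (0 : ℝ) < n := by exact_mod_cast hn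
  have hball : ∀ r : ℝ, 0 ≤ r →
      volume (closedBall (0 : EuclideanSpace ℝ (Fin n)) r) = ENNReal.ofReal (r ^ n) * ν := by
    intro r hr
    rw [Measure.addHaar_closedBall' _ _ hr, finrank_euclideanSpace_fin]
  let S := closedBall (0 : EuclideanSpace ℝ (Fin n)) (1 + τ) \ closedBall 0 (1 - σ)
  let T := {y ∈ closedBall (0 : EuclideanSpace ℝ (Fin n)) 1 |
    ENNReal.ofReal (σ ^ 2 / 4) ≤ ENNReal.ofReal (inner ℝ w y ^ 2)}
  have hsub : (fun y => p + y) ⁻¹' (closedBall p (1 + τ) \ closedBall q (1 - τ)) ⊆ S ∪ T := by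
    rintro y ⟨hy1, hy2⟩
    have hy1' : ‖y‖ ≤ 1 + τ := by simpa [dist_eq_norm] using hy1
    have hy2' : 1 - τ < ‖y - w‖ := by
      have : p + y - q = y - w := by simp only [w]; abel
      rw [← this]
      simpa [dist_eq_norm] using hy2
    by_cases hy : ‖y‖ ≤ 1 - σ
    · right
      refine ⟨by simpa using hy.trans (by linarith), ENNReal.ofReal_le_ofReal ?_⟩
      have e : ‖y - w‖ ^ 2 = ‖y‖ ^ 2 - 2 * inner ℝ y w + ‖w‖ ^ 2 := by
        rw [norm_sub_sq_real]
      have h1 : (1 - τ) ^ 2 ≤ ‖y - w‖ ^ 2 := by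
        gcongr
      have h2 : ‖y‖ ^ 2 ≤ (1 - σ) ^ 2 := by gcongr
      have h3 : ‖w‖ ^ 2 ≤ ω ^ 2 := by gcongr
      rw [real_inner_comm] at e
      have h4 : σ / 2 ≤ -inner ℝ w y := by linarith
      nlinarith
    · left
      exact ⟨by simpa using hy1', by simpa using hy⟩
  have hS : volume S = ENNReal.ofReal ((1 + τ) ^ n - (1 - σ) ^ n) * ν := by
    rw [measure_sdiff (closedBall_subset_closedBall (by linarith))
      isClosed_closedBall.measurableSet.nullMeasurableSet measure_closedBall_lt_top.ne,
      hball _ (by linarith), hball _ (by linarith), ← ENNReal.sub_mul fun _ _ => hνtop,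
      ENNReal.ofReal_sub _ (pow_nonneg (by linarith) n)]
  have hT : volume T ≤ ENNReal.ofReal (4 * ω ^ 2 / (n * σ ^ 2)) * ν := by
    have h1 := mul_meas_ge_le_lintegral (μ := volume.restrict (closedBall 0 1))
      (f := fun y : EuclideanSpace ℝ (Fin n) => ENNReal.ofReal (inner ℝ w y ^ 2))
      (by fun_prop) (ENNReal.ofReal (σ ^ 2 / 4))
    rw [Measure.restrict_apply' isClosed_closedBall.measurableSet, Set.inter_comm] at h1
    have h2 := lintegral_sq_inner_unitBall_le w
    have h3 : ENNReal.ofReal (n * (σ ^ 2 / 4)) * volume T ≤ ENNReal.ofReal (ω ^ 2) * ν := by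
      rw [ENNReal.ofReal_mul (by positivity), ENNReal.ofReal_natCast, mul_assoc]
      refine (mul_le_mul_right h1 _).trans (h2.trans ?_)
      gcongr
    have h4 : 4 * ω ^ 2 / (n * σ ^ 2) = ω ^ 2 / (n * (σ ^ 2 / 4)) := by
      field_simp
    rw [h4, ENNReal.ofReal_div_of_pos (by positivity), ← ENNReal.mul_div_right_comm,
      ENNReal.le_div_iff_mul_le (Or.inl (ENNReal.ofReal_pos.2 (by positivity)).ne')
        (Or.inl ENNReal.ofReal_ne_top),
      mul_comm]
    exact h3
  have hnn : 0 ≤ (1 + τ) ^ n - (1 - σ) ^ n := by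
    have : (1 - σ) ^ n ≤ (1 + τ) ^ n := by
      gcongr; linarith
    linarith
  rw [← measure_preimage_add volume p]
  refine (measure_mono hsub).trans ((measure_union_le _ _).trans ?_)
  rw [ENNReal.ofReal_add hnn (by positivity), add_mul]
  exact add_le_add hS.le hT

end Crescent

/-! ### Volumes and nets on the torus -/

namespace PoissonCovering

open Metric

variable {n : ℕ} (b : Module.Basis (Fin n) ℝ (Space n))

theorem mem_proj_iff {A : Set (Space n)} {u : Space n} :
    (QuotientAddGroup.mk u : Torus b) ∈ proj b A ↔ ∃ l ∈ lattice b, u + l ∈ A := by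
  constructor
  · rintro ⟨a, ha, h⟩
    exact ⟨-u + a, QuotientAddGroup.eq.1 h.symm, by simpa using ha⟩
  · rintro ⟨l, hl, h⟩
    exact ⟨u + l, h, QuotientAddGroup.eq.2 (by simpa using hl)⟩

theorem proj_closedBall_add_of_mem (u : Space n) {l : Space n} (hl : l ∈ lattice b) (r : ℝ) :
    proj b (closedBall (u + l) r) = proj b (closedBall u r) := by
  ext x
  obtain ⟨x, rfl⟩ := QuotientAddGroup.mk_surjective x
  simp only [mem_proj_iff, mem_closedBall, dist_eq_norm]
  constructor
  · rintro ⟨k, hk, h⟩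
    exact ⟨k - l, sub_mem hk hl, by convert h using 2; abel⟩
  · rintro ⟨k, hk, h⟩
    exact ⟨k + l, add_mem hk hl, by convert h using 2; abel⟩

theorem preimage_proj (A : Set (Space n)) :
    (QuotientAddGroup.mk : Space n → Torus b) ⁻¹' proj b A = ⋃ l : lattice b, l +ᵥ A := by
  ext u
  simp only [Set.mem_preimage, mem_proj_iff, Set.mem_iUnion, Set.mem_vadd_set_iff_neg_vadd_mem]
  constructor
  · rintro ⟨l, hl, h⟩
    refine ⟨⟨-l, neg_mem hl⟩, ?_⟩
    convert h using 1
    simp [AddSubgroup.vadd_def, add_comm]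
  · rintro ⟨⟨l, hl⟩, h⟩
    refine ⟨-l, neg_mem hl, ?_⟩
    convert h using 1
    simp [AddSubgroup.vadd_def, add_comm]

instance : Countable (lattice b) :=
  inferInstanceAs (Countable (Submodule.span ℤ (Set.range b)))

theorem measurable_torusMk : Measurable (QuotientAddGroup.mk : Space n → Torus b) :=
  QuotientAddGroup.measurable_coe

theorem measurableSet_proj {A : Set (Space n)} (hA : MeasurableSet A) :
    MeasurableSet (proj b A) := by
  have : MeasurableSet ((QuotientAddGroup.mk : Space n → Torus b) ⁻¹' proj b A) := by
    rw [preimage_proj]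
    exact MeasurableSet.iUnion fun l => hA.const_vadd (l : Space n)
  exact this

theorem torusVolume_proj_eq_measure_iUnion {A : Set (Space n)} (hA : MeasurableSet A) :
    torusVolume b (proj b A) =
      volume (⋃ l : lattice b, (l +ᵥ A) ∩ ZSpan.fundamentalDomain b) := by
  rw [torusVolume, Measure.map_apply (measurable_torusMk b) (measurableSet_proj b hA),
    Measure.restrict_apply' (ZSpan.fundamentalDomain_measurableSet b), preimage_proj,
    Set.iUnion_inter]

instance : VAddInvariantMeasure (lattice b) (Space n) volume :=
  ⟨fun c _ _ => measure_preimage_add volume (c : Space n) _⟩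

theorem volume_eq_tsum_lattice (A : Set (Space n)) :
    volume A = ∑' l : lattice b, volume ((l +ᵥ A) ∩ ZSpan.fundamentalDomain b) := by
  have h : IsAddFundamentalDomain (lattice b) (ZSpan.fundamentalDomain b) volume :=
    ZSpan.isAddFundamentalDomain' b volume
  exact h.measure_eq_tsum A

theorem torusVolume_proj_le {A : Set (Space n)} (hA : MeasurableSet A) :
    torusVolume b (proj b A) ≤ volume A := by
  rw [torusVolume_proj_eq_measure_iUnion b hA, volume_eq_tsum_lattice b A]
  exact measure_iUnion_le _

/-- If the lattice translates of `A` are disjoint, the projection is injective on `A` and so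
preserves its volume. -/
theorem torusVolume_proj_eq {A : Set (Space n)} (hA : MeasurableSet A)
    (h : IsPackingLattice A (lattice b)) : torusVolume b (proj b A) = volume A := by
  rw [torusVolume_proj_eq_measure_iUnion b hA, volume_eq_tsum_lattice b A]
  refine measure_iUnion (fun p q hpq => ?_) fun l =>
    (hA.const_vadd (l : Space n)).inter (ZSpan.fundamentalDomain_measurableSet b)
  exact (h p p.2 q q.2 fun e => hpq (Subtype.ext e)).mono Set.inter_subset_left
    Set.inter_subset_left

theorem torusVolume_univ_ne_top : torusVolume b Set.univ ≠ ⊤ := by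
  rw [torusVolume, Measure.map_apply (measurable_torusMk b) .univ, Set.preimage_univ,
    Measure.restrict_apply_univ]
  exact (ZSpan.fundamentalDomain_isBounded b).measure_lt_top.ne

variable {b}

theorem IsPackingLattice.closedBall {R r : ℝ} (hr : r ≤ R)
    (h : IsPackingLattice (closedBall (0 : Space n) R) (lattice b)) (u : Space n) :
    IsPackingLattice (Metric.closedBall u r) (lattice b) := by
  intro p hp q hq hpq
  have := h p hp q hq hpq
  rw [Set.disjoint_left] at this ⊢
  intro x hx hx'
  simp only [Set.mem_vadd_set_iff_neg_vadd_mem, mem_closedBall, dist_eq_norm, vadd_eq_add]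
    at this hx hx'
  refine this (a := x - u) ?_ ?_
  · refine le_trans (le_of_eq ?_) (hx.trans hr)
    congr 1; abel
  · refine le_trans (le_of_eq ?_) (hx'.trans hr)
    congr 1; abel

theorem volume_closedBall_eq (u : Space n) {r : ℝ} (hr : 0 ≤ r) :
    volume (Metric.closedBall u r) = ENNReal.ofReal (r ^ n) * unitBallVolume n := by
  rw [Measure.addHaar_closedBall' _ _ hr, finrank_euclideanSpace_fin, unitBallVolume]

theorem torusVolume_proj_closedBall
    (h : IsPackingLattice (Metric.closedBall (0 : Space n) 2) (lattice b)) (u : Space n) {r : ℝ}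
    (hr : 0 ≤ r) (hr2 : r ≤ 2) :
    torusVolume b (proj b (Metric.closedBall u r)) = ENNReal.ofReal (r ^ n) * unitBallVolume n := by
  rw [torusVolume_proj_eq b isClosed_closedBall.measurableSet (h.closedBall hr2 u),
    volume_closedBall_eq u hr]

theorem unitBallVolume_pos : 0 < unitBallVolume n :=
  measure_closedBall_pos _ _ one_pos

theorem unitBallVolume_ne_top : unitBallVolume n ≠ ⊤ := measure_closedBall_lt_top.ne

/-- The torus has an `r`-net of the size that the volume bound gives: the centres of a largest
family of disjoint balls of radius `r / 2`. -/
theorem exists_finset_net (h : IsPackingLattice (Metric.closedBall (0 : Space n) 2) (lattice b))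
    {M : ℝ} (hM : 0 < M)
    (hvol : torusVolume b Set.univ ≤ ENNReal.ofReal (M ^ n) * unitBallVolume n) {r : ℝ}
    (hr : 0 < r) (hr4 : r ≤ 4) :
    ∃ N : Finset (Space n), (N.card : ℝ) ≤ (2 * M / r) ^ n ∧
      ∀ u : Space n, ∃ v ∈ N, ∃ l ∈ lattice b, dist (u + l) v ≤ r := by
  let D : Finset (Space n) → Prop := fun N =>
    (N : Set (Space n)).PairwiseDisjoint fun v => proj b (Metric.closedBall v (r / 2))
  have hmeas : ∀ v : Space n, MeasurableSet (proj b (Metric.closedBall v (r / 2))) :=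
    fun v => measurableSet_proj b isClosed_closedBall.measurableSet
  have hcard : ∀ N : Finset (Space n), D N → (N.card : ℝ) ≤ (2 * M / r) ^ n := by
    intro N hN
    have h1 : torusVolume b (⋃ v ∈ N, proj b (Metric.closedBall v (r / 2))) =
        N.card * (ENNReal.ofReal ((r / 2) ^ n) * unitBallVolume n) := by
      rw [measure_biUnion_finset hN fun v _ => hmeas v,
        Finset.sum_congr rfl fun v _ =>
          torusVolume_proj_closedBall h v (by linarith : 0 ≤ r / 2) (by linarith)]
      simp
    have h2 := (h1.symm.le.trans (measure_mono (Set.subset_univ _))).trans hvol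
    rw [← mul_assoc, ENNReal.mul_le_mul_iff_left unitBallVolume_pos.ne' unitBallVolume_ne_top,
      ← ENNReal.ofReal_natCast, ← ENNReal.ofReal_mul (by positivity),
      ENNReal.ofReal_le_ofReal_iff (by positivity)] at h2
    calc (N.card : ℝ) ≤ M ^ n / (r / 2) ^ n := by rwa [le_div_iff₀ (by positivity)]
      _ = (2 * M / r) ^ n := by
        rw [← div_pow]
        congr 1
        field_simp
  obtain ⟨N, hN, hmax⟩ : ∃ N, D N ∧ ∀ N', D N' → N'.card ≤ N.card := by
    obtain ⟨C, hC⟩ := exists_nat_ge ((2 * M / r) ^ n)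
    have hfin : (Finset.card '' {N | D N}).Finite := by
      refine (Set.finite_Iic C).subset ?_
      rintro _ ⟨N, hN, rfl⟩
      exact_mod_cast (hcard N hN).trans hC
    have h0 : D ∅ := by simp [D]
    obtain ⟨_, ⟨N, hN, rfl⟩, hmax⟩ := Set.exists_max_image _ id hfin ⟨_, ∅, h0, rfl⟩
    exact ⟨N, hN, fun N' hN' => hmax _ ⟨N', hN', rfl⟩⟩
  refine ⟨N, hcard N hN, fun u => ?_⟩
  -- By maximality, no further ball of radius `r / 2` is disjoint from the chosen ones.
  have hcommon : ∃ v ∈ N, ¬ Disjoint (proj b (Metric.closedBall u (r / 2)))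
      (proj b (Metric.closedBall v (r / 2))) := by
    by_contra! hdis
    classical
    have hu : u ∉ N := fun hu => by
      have := hdis u hu
      rw [disjoint_self] at this
      have hne : (proj b (Metric.closedBall u (r / 2))).Nonempty :=
        (nonempty_closedBall.2 (by linarith)).image _
      exact hne.ne_empty this
    have h3 : D (insert u N) := by
      simp only [D, Finset.coe_insert]
      exact hN.insert fun v hv _ => hdis v hv
    have h4 := hmax _ h3
    rw [Finset.card_insert_of_notMem hu] at h4
    omega
  obtain ⟨v, hv, hd⟩ := hcommon
  refine ⟨v, hv, ?_⟩
  obtain ⟨_, ⟨x, hx, rfl⟩, hx'⟩ := Set.not_disjoint_iff.1 hd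
  obtain ⟨l, hl, hxl⟩ := (mem_proj_iff b).1 hx'
  refine ⟨l, hl, ?_⟩
  have h1 : dist (u + l) (x + l) ≤ r / 2 := by
    rw [dist_add_right, dist_comm]
    exact hx
  have h2 : dist (x + l) v ≤ r / 2 := hxl
  linarith [dist_triangle (u + l) (x + l) v]

end PoissonCovering

/-! ### Covering and multiplicity from counts at net points -/

namespace PoissonCovering

variable {n : ℕ} {b : Module.Basis (Fin n) ℝ (Space n)}

theorem mk_vadd_proj_closedBall (v : Space n) (r : ℝ) :
    (QuotientAddGroup.mk v : Torus b) +ᵥ proj b (Metric.closedBall 0 r) =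
      proj b (Metric.closedBall v r) := by
  ext x
  obtain ⟨u, rfl⟩ := QuotientAddGroup.mk_surjective x
  rw [Set.mem_vadd_set_iff_neg_vadd_mem, vadd_eq_add, ← QuotientAddGroup.mk_neg,
    ← QuotientAddGroup.mk_add, mem_proj_iff, mem_proj_iff]
  refine exists_congr fun l => and_congr_right fun _ => ?_
  rw [Metric.mem_closedBall, Metric.mem_closedBall, dist_eq_norm, dist_eq_norm]
  rw [show -v + u + l - 0 = u + l - v by abel]

theorem mk_mem_proj_closedBall_comm (u v : Space n) (r : ℝ) :
    (QuotientAddGroup.mk u : Torus b) ∈ proj b (Metric.closedBall v r) ↔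
      (QuotientAddGroup.mk v : Torus b) ∈ proj b (Metric.closedBall u r) := by
  suffices H : ∀ u v : Space n, (QuotientAddGroup.mk u : Torus b) ∈ proj b (Metric.closedBall v r) →
      (QuotientAddGroup.mk v : Torus b) ∈ proj b (Metric.closedBall u r) from ⟨H u v, H v u⟩
  intro u v h
  rw [mem_proj_iff] at h ⊢
  obtain ⟨l, hl, h⟩ := h
  refine ⟨-l, neg_mem hl, ?_⟩
  rw [Metric.mem_closedBall, dist_comm, dist_eq_norm] at *
  rwa [show u - (v + -l) = u + l - v by abel, ← norm_neg, neg_sub]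

theorem multiplicityAt_mk (X : Set (Torus b)) (u : Space n) :
    multiplicityAt (proj b (Metric.closedBall 0 1)) X (QuotientAddGroup.mk u) =
      (X ∩ proj b (Metric.closedBall u 1)).encard := by
  rw [multiplicityAt]
  congr 1
  ext x
  obtain ⟨v, rfl⟩ := QuotientAddGroup.mk_surjective x
  rw [Set.mem_ofPred_eq, mk_vadd_proj_closedBall, mk_mem_proj_closedBall_comm]
  rfl

theorem mk_mem_add_proj_closedBall {X : Set (Torus b)} {u : Space n}
    (h : (X ∩ proj b (Metric.closedBall u 1)).Nonempty) :
    (QuotientAddGroup.mk u : Torus b) ∈ X + proj b (Metric.closedBall 0 1) := by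
  obtain ⟨x, hx, hxu⟩ := h
  obtain ⟨v, rfl⟩ := QuotientAddGroup.mk_surjective x
  rw [mk_mem_proj_closedBall_comm, ← mk_vadd_proj_closedBall] at hxu
  obtain ⟨y, hy, hyu⟩ := hxu
  exact ⟨_, hx, y, hy, hyu⟩

theorem coveringDensity_eq (h : IsPackingLattice (Metric.closedBall (0 : Space n) 2) (lattice b))
    (X : Set (Torus b)) :
    coveringDensity (torusVolume b) (proj b (Metric.closedBall 0 1)) X Set.univ =
      X.encard * (unitBallVolume n / torusVolume b Set.univ) := by
  have h1 : ∀ p : X, torusVolume b (Set.univ ∩ ((p : Torus b) +ᵥ proj b (Metric.closedBall 0 1))) =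
      unitBallVolume n := by
    rintro ⟨p, _⟩
    obtain ⟨v, rfl⟩ := QuotientAddGroup.mk_surjective p
    rw [Set.univ_inter, mk_vadd_proj_closedBall,
      torusVolume_proj_closedBall h v zero_le_one one_le_two]
    simp
  simp only [coveringDensity, h1]
  rw [ENNReal.tsum_const]
  rfl

/-- `crescent b p q τ` is the projection of the ball of radius `1 + τ` around `p`, without that of
the ball of radius `1 - τ` around `q`. -/
def crescent (b : Module.Basis (Fin n) ℝ (Space n)) (p q : Space n) (τ : ℝ) : Set (Torus b) :=
  proj b (Metric.closedBall p (1 + τ)) \ proj b (Metric.closedBall q (1 - τ))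

theorem measurableSet_crescent (p q : Space n) (τ : ℝ) : MeasurableSet (crescent b p q τ) :=
  (measurableSet_proj b Metric.isClosed_closedBall.measurableSet).diff
    (measurableSet_proj b Metric.isClosed_closedBall.measurableSet)

theorem torusVolume_crescent_le (p q : Space n) (τ : ℝ) {l : Space n} (hl : l ∈ lattice b) :
    torusVolume b (crescent b p q τ) ≤
      volume (Metric.closedBall (p + l) (1 + τ) \ Metric.closedBall q (1 - τ)) := by
  rw [crescent, ← proj_closedBall_add_of_mem b p hl]
  refine (measure_mono ?_).trans (torusVolume_proj_le b
    (Metric.isClosed_closedBall.measurableSet.diff Metric.isClosed_closedBall.measurableSet))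
  rintro x ⟨⟨y, hy, rfl⟩, hx⟩
  exact ⟨y, ⟨hy, fun hy' => hx ⟨y, hy', rfl⟩⟩, rfl⟩

/-- `p` and `q` are within distance `r` on the torus. -/
def IsNear (b : Module.Basis (Fin n) ℝ (Space n)) (r : ℝ) (p q : Space n) : Prop :=
  ∃ l ∈ lattice b, dist (p + l) q ≤ r

theorem IsNear.symm {r : ℝ} {p q : Space n} (h : IsNear b r p q) : IsNear b r q p := by
  obtain ⟨l, hl, h⟩ := h
  refine ⟨-l, neg_mem hl, ?_⟩
  rw [dist_comm, dist_eq_norm] at *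
  rwa [show p - (q + -l) = p + l - q by abel, ← norm_neg, neg_sub]

/-- Coarse and fine net points `v` and `q` near `u`. The triangle inequality is applied in `ℝⁿ`, to
one representative of each point of the torus. -/
theorem exists_net_points {N₁ N₂ : Finset (Space n)} {η τ : ℝ}
    (h₁ : ∀ u : Space n, ∃ v ∈ N₁, ∃ l ∈ lattice b, dist (u + l) v ≤ η)
    (h₂ : ∀ u : Space n, ∃ v ∈ N₂, ∃ l ∈ lattice b, dist (u + l) v ≤ τ) (u : Space n) :
    ∃ v ∈ N₁, ∃ q ∈ N₂, IsNear b (η + τ) v q ∧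
      proj b (Metric.closedBall q (1 - τ)) ⊆ proj b (Metric.closedBall u 1) ∧
      proj b (Metric.closedBall u 1) ⊆ proj b (Metric.closedBall q (1 + τ)) := by
  obtain ⟨v, hv, k, hk, hd⟩ := h₁ u
  obtain ⟨q, hq, l, hl, hd'⟩ := h₂ (u + k)
  rw [← proj_closedBall_add_of_mem b u hk, ← proj_closedBall_add_of_mem b (u + k) hl]
  refine ⟨v, hv, q, hq, ⟨l, hl, ?_⟩, Set.image_mono (Metric.closedBall_subset_closedBall' ?_),
    Set.image_mono (Metric.closedBall_subset_closedBall' ?_)⟩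
  · have : dist (v + l) (u + k + l) ≤ η := by rwa [dist_add_right, dist_comm]
    linarith [dist_triangle (v + l) (u + k + l) q]
  · rw [dist_comm]; linarith
  · linarith

/-- If every coarse net point has more than `α` points of `X` in its unit ball and every crescent
of near net points has at most `α` of them, then no unit ball can miss `X`: otherwise the points
in the unit ball of a nearby coarse net point would all lie in one crescent. -/
theorem univ_subset_add_proj_closedBall {X : Set (Torus b)} {N₁ N₂ : Finset (Space n)} {η τ : ℝ}
    {α : ℝ≥0∞} (hτ : 0 ≤ τ)
    (h₁ : ∀ u : Space n, ∃ v ∈ N₁, ∃ l ∈ lattice b, dist (u + l) v ≤ η)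
    (h₂ : ∀ u : Space n, ∃ v ∈ N₂, ∃ l ∈ lattice b, dist (u + l) v ≤ τ)
    (hball : ∀ v ∈ N₁, α < (X ∩ proj b (Metric.closedBall v 1)).encard)
    (hcres : ∀ v ∈ N₁, ∀ q ∈ N₂, IsNear b (η + τ) v q → (X ∩ crescent b v q τ).encard ≤ α) :
    Set.univ ⊆ X + proj b (Metric.closedBall 0 1) := by
  intro x _
  obtain ⟨u, rfl⟩ := QuotientAddGroup.mk_surjective x
  apply mk_mem_add_proj_closedBall
  by_contra hemp
  obtain ⟨v, hv, q, hq, hnear, hsub, -⟩ := exists_net_points h₁ h₂ u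
  refine absurd (hcres v hv q hq hnear) (not_le.2 ((hball v hv).trans_le ?_))
  refine ENat.toENNReal_le.2 (Set.encard_le_encard fun x hx => ⟨hx.1, ?_, fun hxq => ?_⟩)
  · exact Set.image_mono (Metric.closedBall_subset_closedBall (by linarith)) hx.2
  · exact hemp ⟨x, hx.1, hsub hxq⟩

/-- A unit ball is contained in the unit ball of a nearby coarse net point together with one
crescent. -/
theorem coveringMultiplicity_le {X : Set (Torus b)} {N₁ N₂ : Finset (Space n)} {η τ : ℝ}
    {α β : ℝ≥0∞} (hτ : 0 ≤ τ)
    (h₁ : ∀ u : Space n, ∃ v ∈ N₁, ∃ l ∈ lattice b, dist (u + l) v ≤ η)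
    (h₂ : ∀ u : Space n, ∃ v ∈ N₂, ∃ l ∈ lattice b, dist (u + l) v ≤ τ)
    (hball : ∀ v ∈ N₁, (X ∩ proj b (Metric.closedBall v 1)).encard ≤ β)
    (hcres : ∀ v ∈ N₁, ∀ q ∈ N₂, IsNear b (η + τ) q v → (X ∩ crescent b q v τ).encard ≤ α) :
    (coveringMultiplicity (proj b (Metric.closedBall 0 1)) X Set.univ : ℝ≥0∞) ≤ β + α := by
  have hpt : ∀ u : Space n, ((X ∩ proj b (Metric.closedBall u 1)).encard : ℝ≥0∞) ≤ β + α := by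
    intro u
    obtain ⟨v, hv, q, hq, hnear, -, hsub⟩ := exists_net_points h₁ h₂ u
    refine le_trans ?_ (add_le_add (hball v hv) (hcres v hv q hq hnear.symm))
    rw [← ENat.toENNReal_add]
    refine ENat.toENNReal_le.2 (le_trans (Set.encard_le_encard ?_) (Set.encard_union_le _ _))
    rintro x ⟨hx, hxu⟩
    by_cases hxv : x ∈ proj b (Metric.closedBall v 1)
    · exact Or.inl ⟨hx, hxv⟩
    · refine Or.inr ⟨hx, hsub hxu, fun h => hxv ?_⟩
      exact Set.image_mono (Metric.closedBall_subset_closedBall (by linarith)) h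
  simp only [coveringMultiplicity, ENat.toENNReal_iSup]
  refine iSup₂_le fun x _ => ?_
  obtain ⟨u, rfl⟩ := QuotientAddGroup.mk_surjective x
  rw [multiplicityAt_mk]
  exact hpt u

end PoissonCovering

/-! ### The failure probability on a fixed torus -/

namespace PoissonCovering

variable {n : ℕ} {b : Module.Basis (Fin n) ℝ (Space n)}

theorem measure_biUnion_finset_le_card_mul {Ω ι : Type*} [MeasurableSpace Ω] (P : Measure Ω)
    (s : Finset ι) (f : ι → Set Ω) {c r : ℝ} (hs : (s.card : ℝ) ≤ c) (hr : 0 ≤ r)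
    (h : ∀ i ∈ s, P (f i) ≤ ENNReal.ofReal r) :
    P (⋃ i ∈ s, f i) ≤ ENNReal.ofReal (c * r) := by
  calc P (⋃ i ∈ s, f i) ≤ ∑ i ∈ s, P (f i) := measure_biUnion_finset_le s f
    _ ≤ s.card * ENNReal.ofReal r := by
      simpa using Finset.sum_le_card_nsmul s _ _ h
    _ = ENNReal.ofReal (s.card * r) := by
      rw [ENNReal.ofReal_mul (by positivity), ENNReal.ofReal_natCast]
    _ ≤ _ := ENNReal.ofReal_le_ofReal (by gcongr)

theorem unitBallVolume_le_torusVolume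
    (hpack : IsPackingLattice (Metric.closedBall (0 : Space n) 2) (lattice b)) :
    unitBallVolume n ≤ torusVolume b Set.univ := by
  have := torusVolume_proj_closedBall hpack 0 zero_le_one one_le_two
  rw [one_pow, ENNReal.ofReal_one, one_mul] at this
  rw [← this]
  exact measure_mono (Set.subset_univ _)

theorem coveringDensity_le_of_encard_le
    (hpack : IsPackingLattice (Metric.closedBall (0 : Space n) 2) (lattice b))
    {X : Set (Torus b)} {D : ℝ} (hD : 0 ≤ D)
    (hX : (X.encard : ℝ≥0∞) ≤ ENNReal.ofReal
      (D * ((torusVolume b Set.univ).toReal / (unitBallVolume n).toReal))) :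
    coveringDensity (torusVolume b) (proj b (Metric.closedBall 0 1)) X Set.univ ≤
      ENNReal.ofReal D := by
  have hν := ENNReal.toReal_pos (unitBallVolume_pos (n := n)).ne' unitBallVolume_ne_top
  have hV0 : torusVolume b Set.univ ≠ 0 :=
    (unitBallVolume_pos.trans_le (unitBallVolume_le_torusVolume hpack)).ne'
  have hV := ENNReal.toReal_pos hV0 (torusVolume_univ_ne_top b)
  rw [coveringDensity_eq hpack]
  refine (mul_le_mul_left hX _).trans (le_of_eq ?_)
  rw [← ENNReal.ofReal_toReal (unitBallVolume_ne_top (n := n)),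
    ← ENNReal.ofReal_toReal (torusVolume_univ_ne_top b), ← ENNReal.ofReal_div_of_pos hV,
    ← ENNReal.ofReal_mul (by positivity), ENNReal.toReal_ofReal hν.le, ENNReal.toReal_ofReal hV.le]
  congr 1
  field_simp

/-- The union bound over the four ways to fail: some unit ball at a coarse net point has at most
`a` points of `X`, or at least `B`; some crescent at near net points has at least `a` points;
`X` is too large. Each is a Chernoff bound, with parameters `γ`, `e`, `exp K` and `exp x`. -/
theorem measure_compl_le_of_isPoissonProcess
    (hpack : IsPackingLattice (Metric.closedBall (0 : Space n) 2) (lattice b))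
    {M : ℝ} (hM : 0 < M)
    (hvol : torusVolume b Set.univ ≤ ENNReal.ofReal (M ^ n) * unitBallVolume n)
    {Ω : Type*} [MeasurableSpace Ω] {P : Measure Ω} {X : Ω → Set (Torus b)} {ρ : ℝ≥0}
    (hX : IsPoissonProcess b P X ρ) {η τ κ γ a B K x D ℓ : ℝ}
    (hℓ : ρ * (unitBallVolume n).toReal = ℓ)
    (hη : 0 < η) (hη4 : η ≤ 4) (hτ : 0 < τ) (hτ4 : τ ≤ 4) (hκ : 0 ≤ κ)
    (hcres : ∀ p q : Space n, dist p q ≤ η + τ →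
      volume (Metric.closedBall p (1 + τ) \ Metric.closedBall q (1 - τ)) ≤
        ENNReal.ofReal κ * unitBallVolume n)
    (hγ0 : 0 < γ) (hγ1 : γ ≤ 1) (ha : 0 ≤ a) (hB : 0 ≤ B) (hK : 0 ≤ K) (hx : 0 ≤ x) (hD : 0 ≤ D)
    (hxD : ℓ * (Real.exp x - 1) - D * x ≤ 0) :
    P {ω |
        (Set.univ ⊆ X ω + proj b (Metric.closedBall (0 : Space n) 1) ∧
          coveringDensity (torusVolume b) (proj b (Metric.closedBall (0 : Space n) 1))
            (X ω) Set.univ ≤ ENNReal.ofReal D ∧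
          (coveringMultiplicity (proj b (Metric.closedBall (0 : Space n) 1))
            (X ω) Set.univ : ℝ≥0∞) ≤ ENNReal.ofReal (B + a))}ᶜ ≤
      ENNReal.ofReal ((2 * M / η) ^ n * Real.exp (ℓ * (γ - 1) - a * Real.log γ)) +
      ENNReal.ofReal ((2 * M / η) ^ n * Real.exp (ℓ * (Real.exp 1 - 1) - B)) +
      2 * ENNReal.ofReal ((2 * M / η) ^ n * ((2 * M / τ) ^ n *
        Real.exp (ℓ * κ * (Real.exp K - 1) - a * K))) +
      ENNReal.ofReal (Real.exp (ℓ * (Real.exp x - 1) - D * x)) := by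
  have hν := ENNReal.toReal_pos (unitBallVolume_pos (n := n)).ne' unitBallVolume_ne_top
  have hℓ0 : 0 ≤ ℓ := by rw [← hℓ]; positivity
  obtain ⟨N₁, hc₁, hnet₁⟩ := exists_finset_net hpack hM hvol hη hη4
  obtain ⟨N₂, hc₂, hnet₂⟩ := exists_finset_net hpack hM hvol hτ hτ4
  have hlaw : ∀ v : Space n, HasLaw (fun ω => (X ω ∩ proj b (Metric.closedBall v 1)).encard)
      ((poissonMeasure (ρ * (unitBallVolume n).toNNReal)).map (Nat.cast : ℕ → ℕ∞)) P := by
    intro v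
    have := hX.law _ (measurableSet_proj b
      (Metric.isClosed_closedBall (x := v) (ε := 1)).measurableSet)
    rwa [torusVolume_proj_closedBall hpack v zero_le_one one_le_two, one_pow, ENNReal.ofReal_one,
      one_mul] at this
  have hrate : ((ρ * (unitBallVolume n).toNNReal : ℝ≥0) : ℝ) = ℓ := by
    rw [NNReal.coe_mul, ← hℓ]; rfl
  let S₁ := ⋃ v ∈ N₁, {ω | ((X ω ∩ proj b (Metric.closedBall v 1)).encard : ℝ≥0∞) ≤
    ENNReal.ofReal a}
  let S₂ := ⋃ v ∈ N₁, {ω | ENNReal.ofReal B ≤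
    ((X ω ∩ proj b (Metric.closedBall v 1)).encard : ℝ≥0∞)}
  let F : Space n → Space n → Set Ω := fun p q =>
    {ω | IsNear b (η + τ) p q ∧ ENNReal.ofReal a ≤ ((X ω ∩ crescent b p q τ).encard : ℝ≥0∞)}
  let S₃ := ⋃ v ∈ N₁, ⋃ q ∈ N₂, F v q
  let S₄ := ⋃ v ∈ N₁, ⋃ q ∈ N₂, F q v
  let S₅ := {ω | ENNReal.ofReal
    (D * ((torusVolume b Set.univ).toReal / (unitBallVolume n).toReal)) ≤ ((X ω).encard : ℝ≥0∞)}
  have h₁ : P S₁ ≤ ENNReal.ofReal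
      ((2 * M / η) ^ n * Real.exp (ℓ * (γ - 1) - a * Real.log γ)) := by
    refine measure_biUnion_finset_le_card_mul P N₁ _ hc₁ (Real.exp_pos _).le fun v _ => ?_
    have := measure_le_le_of_hasLaw_poisson (hlaw v) hγ0 hγ1 ha
    rwa [hrate] at this
  have h₂ : P S₂ ≤ ENNReal.ofReal ((2 * M / η) ^ n * Real.exp (ℓ * (Real.exp 1 - 1) - B)) := by
    refine measure_biUnion_finset_le_card_mul P N₁ _ hc₁ (Real.exp_pos _).le fun v _ => ?_
    have := measure_ge_le_of_hasLaw_poisson (hlaw v) (Real.one_le_exp zero_le_one) B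
    rwa [hrate, Real.log_exp, mul_one] at this
  have hF : ∀ p q, P (F p q) ≤
      ENNReal.ofReal (Real.exp (ℓ * κ * (Real.exp K - 1) - a * K)) := by
    intro p q
    by_cases hpq : IsNear b (η + τ) p q
    · have hlaw' := measure_ge_le_of_hasLaw_poisson
        (hX.law (crescent b p q τ) (measurableSet_crescent p q τ)) (Real.one_le_exp hK) a
      refine (measure_mono fun ω hω => hω.2).trans (hlaw'.trans ?_)
      rw [Real.log_exp]
      obtain ⟨l, hl, hd⟩ := hpq
      have hle := (torusVolume_crescent_le p q τ hl).trans (hcres _ _ hd)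
      have hle' : (torusVolume b (crescent b p q τ)).toReal ≤ κ * (unitBallVolume n).toReal := by
        have := ENNReal.toReal_mono (ENNReal.mul_ne_top ENNReal.ofReal_ne_top
          unitBallVolume_ne_top) hle
        rwa [ENNReal.toReal_mul, ENNReal.toReal_ofReal hκ] at this
      have h1 : ((ρ * (torusVolume b (crescent b p q τ)).toNNReal : ℝ≥0) : ℝ) ≤ ℓ * κ := by
        rw [NNReal.coe_mul, ← hℓ, mul_assoc, mul_comm (unitBallVolume n).toReal]
        exact mul_le_mul_of_nonneg_left hle' ρ.2
      have h2 := Real.one_le_exp hK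
      gcongr
    · have : F p q = ∅ := Set.eq_empty_of_forall_notMem fun ω hω => hpq hω.1
      simp [this]
  have h₃ : P S₃ ≤ ENNReal.ofReal ((2 * M / η) ^ n * ((2 * M / τ) ^ n *
        Real.exp (ℓ * κ * (Real.exp K - 1) - a * K))) :=
    measure_biUnion_finset_le_card_mul P N₁ _ hc₁ (by positivity) fun v _ =>
      measure_biUnion_finset_le_card_mul P N₂ _ hc₂ (Real.exp_pos _).le fun q _ => hF v q
  have h₄ : P S₄ ≤ ENNReal.ofReal ((2 * M / η) ^ n * ((2 * M / τ) ^ n *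
        Real.exp (ℓ * κ * (Real.exp K - 1) - a * K))) :=
    measure_biUnion_finset_le_card_mul P N₁ _ hc₁ (by positivity) fun v _ =>
      measure_biUnion_finset_le_card_mul P N₂ _ hc₂ (Real.exp_pos _).le fun q _ => hF q v
  have h₅ : P S₅ ≤ ENNReal.ofReal (Real.exp (ℓ * (Real.exp x - 1) - D * x)) := by
    have hlaw' := hX.law Set.univ .univ
    simp only [Set.inter_univ] at hlaw'
    refine (measure_ge_le_of_hasLaw_poisson hlaw' (Real.one_le_exp hx) _).trans ?_
    set R := (torusVolume b Set.univ).toReal / (unitBallVolume n).toReal with hRdef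
    have hR : 1 ≤ R := by
      rw [hRdef, one_le_div hν]
      exact ENNReal.toReal_mono (torusVolume_univ_ne_top b) (unitBallVolume_le_torusVolume hpack)
    have h1 : ((ρ * (torusVolume b Set.univ).toNNReal : ℝ≥0) : ℝ) = ℓ * R := by
      rw [NNReal.coe_mul, ← hℓ, hRdef, mul_assoc, mul_div_cancel₀ _ hν.ne']
      rfl
    rw [h1, Real.log_exp]
    refine ENNReal.ofReal_le_ofReal (Real.exp_le_exp.2 ?_)
    nlinarith
  have hsub : {ω |
        (Set.univ ⊆ X ω + proj b (Metric.closedBall (0 : Space n) 1) ∧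
          coveringDensity (torusVolume b) (proj b (Metric.closedBall (0 : Space n) 1))
            (X ω) Set.univ ≤ ENNReal.ofReal D ∧
          (coveringMultiplicity (proj b (Metric.closedBall (0 : Space n) 1))
            (X ω) Set.univ : ℝ≥0∞) ≤ ENNReal.ofReal (B + a))}ᶜ ⊆
      S₁ ∪ S₂ ∪ (S₃ ∪ S₄) ∪ S₅ := by
    intro ω hω
    by_contra hgood
    simp only [Set.mem_union, not_or, S₁, S₂, S₃, S₄, S₅, F, Set.mem_iUnion, Set.mem_ofPred_eq,
      not_exists, not_and, not_le] at hgood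
    obtain ⟨⟨⟨g₁, g₂⟩, g₃, g₄⟩, g₅⟩ := hgood
    refine hω ⟨?_, ?_, ?_⟩
    · exact univ_subset_add_proj_closedBall hτ.le hnet₁ hnet₂ g₁
        fun v hv q hq h => (g₃ v hv q hq h).le
    · exact coveringDensity_le_of_encard_le hpack hD g₅.le
    · rw [ENNReal.ofReal_add hB ha]
      exact coveringMultiplicity_le hτ.le hnet₁ hnet₂ (fun v hv => (g₂ v hv).le)
        fun v hv q hq h => (g₄ v hv q hq h).le
  calc _ ≤ P (S₁ ∪ S₂ ∪ (S₃ ∪ S₄) ∪ S₅) := measure_mono hsub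
    _ ≤ P S₁ + P S₂ + (P S₃ + P S₄) + P S₅ :=
      (measure_union_le _ _).trans (add_le_add ((measure_union_le _ _).trans
        (add_le_add (measure_union_le _ _) (measure_union_le _ _))) le_rfl)
    _ ≤ _ := add_le_add (add_le_add (add_le_add h₁ h₂)
        ((add_le_add h₃ h₄).trans_eq (two_mul _).symm)) h₅

end PoissonCovering

/-! ### Asymptotics in the dimension -/

theorem tendsto_natCast_rpow_neg {s : ℝ} (hs : 0 < s) :
    Tendsto (fun n : ℕ => (n : ℝ) ^ (-s)) atTop (nhds 0) :=
  (tendsto_rpow_neg_atTop hs).comp tendsto_natCast_atTop_atTop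

theorem tendsto_exp_mul_sub_mul_mul_log (C : ℝ) {d : ℝ} (hd : 0 < d) :
    Tendsto (fun n : ℕ => Real.exp (C * n - d * (n * Real.log n))) atTop (nhds 0) := by
  have h1 : Tendsto (fun n : ℕ => d * Real.log n + -C) atTop atTop :=
    tendsto_atTop_add_const_right _ _
      ((Real.tendsto_log_atTop.comp tendsto_natCast_atTop_atTop).const_mul_atTop hd)
  have h2 : Tendsto (fun n : ℕ => (n : ℝ) * (d * Real.log n + -C)) atTop atTop :=
    tendsto_natCast_atTop_atTop.atTop_mul_atTop₀ h1
  refine (Real.tendsto_exp_neg_atTop_nhds_zero.comp h2).congr fun n => ?_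
  simp only [Function.comp_apply]
  congr 1
  ring

/-- In units of the ball volume, a crescent between balls at distance `n ^ (-(1 / 2 + δ / 4))` has
vanishing volume. -/
theorem eventually_volume_closedBall_diff_closedBall_le {δ κ : ℝ} (hδ : 0 < δ) (hδ1 : δ < 1)
    (hκ : 0 < κ) :
    ∀ᶠ n : ℕ in atTop, ∀ p q : EuclideanSpace ℝ (Fin n),
      dist p q ≤ (n : ℝ) ^ (-(1 / 2 + δ / 4)) + (n : ℝ) ^ (-2 : ℝ) →
      volume (Metric.closedBall p (1 + (n : ℝ) ^ (-2 : ℝ)) \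
          Metric.closedBall q (1 - (n : ℝ) ^ (-2 : ℝ))) ≤
        ENNReal.ofReal κ * volume (Metric.closedBall (0 : EuclideanSpace ℝ (Fin n)) 1) := by
  have hy := tendsto_natCast_rpow_neg (s := δ / 8) (by linarith)
  have hx := tendsto_natCast_rpow_neg (s := 1) one_pos
  have hz := tendsto_natCast_rpow_neg (s := 1 - δ / 8) (by linarith)
  have hlim : Tendsto (fun n : ℕ => Real.exp ((n : ℝ) ^ (-1 : ℝ)) - 1 + (n : ℝ) ^ (-(δ / 8)) +
      16 * ((n : ℝ) ^ (-(δ / 8))) ^ 2) atTop (nhds 0) := by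
    have := (((Real.continuous_exp.tendsto 0).comp hx).sub_const 1).add hy |>.add
      ((hy.pow 2).const_mul 16)
    simpa using this
  filter_upwards [eventually_ge_atTop 1, hlim.eventually (eventually_le_nhds hκ),
    hy.eventually (eventually_le_nhds (show (0 : ℝ) < 1 / 4 by norm_num)),
    hz.eventually (eventually_le_nhds (show (0 : ℝ) < 1 / 4 by norm_num))]
    with n hn hg hy4 hz4 p q hpq
  have hn1 : (1 : ℝ) ≤ n := by exact_mod_cast hn
  have hn0 : (0 : ℝ) < n := by linarith
  rw [Real.rpow_neg_one] at hg
  set x := (n : ℝ) with hxdef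
  set y := x ^ (-(δ / 8)) with hydef
  have hy0 : 0 < y := Real.rpow_pos_of_pos hn0 _
  -- All scales are powers of `x⁻¹` and `y`: the shell has width `σ = x⁻¹ * y`, which is `o(1 / n)`,
  -- while the squared distance `η ^ 2 = x⁻¹ * y ^ 4` is `o(σ)` and `o(n * σ ^ 2)`.
  have hη : (x ^ (-(1 / 2 + δ / 4))) ^ 2 = x⁻¹ * y ^ 4 := by
    rw [hydef, ← Real.rpow_natCast, ← Real.rpow_natCast, ← Real.rpow_mul hn0.le,
      ← Real.rpow_mul hn0.le, ← Real.rpow_neg_one, ← Real.rpow_add hn0]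
    congr 1
    push_cast
    ring
  have hτ : x ^ (-2 : ℝ) = x⁻¹ * x⁻¹ := by
    rw [← Real.rpow_neg_one, ← Real.rpow_add hn0]
    norm_num
  have hzy : x⁻¹ ≤ y / 4 := by
    have : x⁻¹ = y * x ^ (-(1 - δ / 8)) := by
      rw [hydef, ← Real.rpow_neg_one, ← Real.rpow_add hn0]
      congr 1
      ring
    rw [this]
    nlinarith
  have hx1 : x⁻¹ ≤ 1 := inv_le_one_of_one_le₀ hn1
  have hxpos : 0 < x⁻¹ := inv_pos.2 hn0
  set η := x ^ (-(1 / 2 + δ / 4)) with hηdef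
  have hη0 : 0 < η := Real.rpow_pos_of_pos hn0 _
  have hτη : x ^ (-2 : ℝ) ≤ η :=
    Real.rpow_le_rpow_of_exponent_le hn1 (by linarith)
  rw [hτ] at hpq hτη ⊢
  have hσ1 : x⁻¹ * y ≤ 1 := by nlinarith
  have hxx : x⁻¹ * x⁻¹ ≤ x⁻¹ * y / 4 := by nlinarith
  have hside : (1 - x⁻¹ * y) ^ 2 + (2 * η) ^ 2 + x⁻¹ * y ≤ (1 - x⁻¹ * x⁻¹) ^ 2 := by
    have e1 : (2 * η) ^ 2 ≤ x⁻¹ * y / 4 := by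
      rw [mul_pow, hη]
      have : y ^ 4 ≤ y / 64 := by
        have h3 : y ^ 3 ≤ (1 / 4) ^ 3 := by gcongr
        nlinarith
      nlinarith
    have e2 : (x⁻¹ * y) ^ 2 ≤ x⁻¹ * y / 4 := by
      have : x⁻¹ * y ≤ 1 / 4 := by nlinarith
      nlinarith [mul_pos hxpos hy0]
    nlinarith [sq_nonneg (x⁻¹ * x⁻¹)]
  refine (volume_closedBall_diff_closedBall_le p q (τ := x⁻¹ * x⁻¹) (σ := x⁻¹ * y) (ω := 2 * η)
    (by positivity) (by nlinarith) (by positivity) hσ1 hn (by linarith) hside).trans ?_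
  gcongr
  refine le_trans ?_ hg
  have e1 : (1 + x⁻¹ * x⁻¹) ^ n ≤ Real.exp x⁻¹ := by
    calc (1 + x⁻¹ * x⁻¹) ^ n ≤ Real.exp (x⁻¹ * x⁻¹) ^ n := by
          gcongr
          linarith [Real.add_one_le_exp (x⁻¹ * x⁻¹)]
      _ = Real.exp x⁻¹ := by
          rw [← Real.exp_nat_mul, ← hxdef]
          congr 1
          field_simp
  have e2 : 1 - y ≤ (1 - x⁻¹ * y) ^ n := by
    have := one_add_mul_le_pow (a := -(x⁻¹ * y)) (by linarith) n
    rw [← hxdef] at this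
    have h : 1 + x * -(x⁻¹ * y) = 1 - y := by field_simp; ring
    rw [h] at this
    rwa [← sub_eq_add_neg] at this
  have e3 : 4 * (2 * η) ^ 2 / (x * (x⁻¹ * y) ^ 2) = 16 * y ^ 2 := by
    rw [mul_pow, hη]
    field_simp
    norm_num
  rw [e3]
  linarith

theorem div_rpow_neg_pow_eq_exp {M : ℝ} (hM : 0 < M) {n : ℕ} (hn : 0 < n) (s : ℝ) :
    (2 * M / (n : ℝ) ^ (-s)) ^ n = Real.exp (Real.log (2 * M) * n + s * (n * Real.log n)) := by
  have hn' : (0 : ℝ) < n := by exact_mod_cast hn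
  rw [Real.rpow_def_of_pos hn', ← Real.exp_log (show 0 < 2 * M by linarith), ← Real.exp_sub,
    ← Real.exp_nat_mul, Real.log_exp]
  congr 1
  ring

/-- The intensity is chosen so that the expected number of points in a unit ball is
`(1 / 2 + δ) * n * log n`. -/
theorem intensity_mul_unitBallVolume {n : ℕ} {r : ℝ} (hr : 0 ≤ r) :
    ((r / (PoissonCovering.unitBallVolume n).toReal).toNNReal : ℝ) *
      (PoissonCovering.unitBallVolume n).toReal = r := by
  have hν := ENNReal.toReal_pos (PoissonCovering.unitBallVolume_pos (n := n)).ne'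
    PoissonCovering.unitBallVolume_ne_top
  rw [Real.coe_toNNReal _ (by positivity), div_mul_cancel₀ _ hν.ne']

theorem theorem2 :
    ∃ ξ : ℝ, 1.79556 ≤ ξ ∧ ξ < 1.79557 ∧
      (∀ x : ℝ, 0 < x → (Real.log (2 * x / Real.exp 1) = 1 / (2 * x) ↔ x = ξ)) ∧
      ∀ δ M : ℝ, 0 < δ → δ < 1 → 0 < M →
        -- The failure probability tends to 0 as n tends to infinity, uniformly in the torus.
        -- The failure set is bounded in outer measure, so no measurability is at issue.
        ∀ ε : ℝ, 0 < ε → ∀ᶠ n : ℕ in atTop,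
          ∀ b : Module.Basis (Fin n) ℝ (PoissonCovering.Space n),
            PoissonCovering.IsPackingLattice (Metric.closedBall (0 : PoissonCovering.Space n) 2)
              (PoissonCovering.lattice b) →
            PoissonCovering.torusVolume b Set.univ
              ≤ ENNReal.ofReal (M ^ n) * PoissonCovering.unitBallVolume n →
            ∀ (Ω : Type*) [MeasurableSpace Ω] (P : Measure Ω) [IsProbabilityMeasure P]
              (X : Ω → Set (PoissonCovering.Torus b)),
              PoissonCovering.IsPoissonProcess b P X
                ((1 / 2 + δ) * (n * Real.log n)
                  / (PoissonCovering.unitBallVolume n).toReal).toNNReal →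
              P {ω |
                (Set.univ ⊆ X ω +
                    PoissonCovering.proj b (Metric.closedBall (0 : PoissonCovering.Space n) 1) ∧
                  PoissonCovering.coveringDensity (PoissonCovering.torusVolume b)
                      (PoissonCovering.proj b
                        (Metric.closedBall (0 : PoissonCovering.Space n) 1))
                      (X ω) Set.univ
                    ≤ ENNReal.ofReal ((1 / 2 + 2 * δ) * (n * Real.log n)) ∧
                  (PoissonCovering.coveringMultiplicity
                      (PoissonCovering.proj b
                        (Metric.closedBall (0 : PoissonCovering.Space n) 1))
                      (X ω) Set.univ : ℝ≥0∞)
                    ≤ ENNReal.ofReal ((ξ + 10 * δ) * (n * Real.log n)))}ᶜ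
                ≤ ENNReal.ofReal ε := by
  obtain ⟨ξ, hξ, hξ', hroot⟩ := existsUnique_root_log_eq
  refine ⟨ξ, hξ, hξ', hroot, fun δ M hδ hδ1 hM ε hε => ?_⟩
  have hlogδ : 1 - δ / 6 ≤ -Real.log (δ / 6) := by
    linarith [Real.log_le_sub_one_of_pos (show 0 < δ / 6 by positivity)]
  -- `c * n * log n` is the number of points below which a ball counts as nearly empty.
  let c : ℝ := δ / (4 * -Real.log (δ / 6))
  have hc0 : 0 < c := div_pos hδ (by linarith)
  have hcδ : c ≤ δ := div_le_self hδ.le (by linarith)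
  have hclog : c * Real.log (δ / 6) = -(δ / 4) := by
    have : Real.log (δ / 6) ≠ 0 := by linarith
    simp only [c]
    field_simp
  -- A crescent reaches `c * n * log n` points with probability at most `exp (-c * K * n * log n)`,
  -- up to a factor `exp (3 / 2 * n * log n)`; the value `c * K = 5` outweighs that and both nets.
  let K : ℝ := 5 / c
  have hcK : c * K = 5 := by simp only [K]; field_simp
  have hK0 : 0 < K := by positivity
  let C : ℝ := 2 * |Real.log (2 * M)|
  have hlim := tendsto_exp_mul_sub_mul_mul_log C (d := δ ^ 2 / 8) (by positivity)
  filter_upwards [eventually_ge_atTop 1,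
    hlim.eventually (eventually_le_nhds (show 0 < ε / 5 by positivity)),
    eventually_volume_closedBall_diff_closedBall_le hδ hδ1 (Real.exp_pos (-K))]
    with n hn hsmall hcres b hpack hvol Ω _ P _ X hX
  have hn1 : (1 : ℝ) ≤ n := by exact_mod_cast hn
  set L : ℝ := n * Real.log n with hL
  have hL0 : 0 ≤ L := mul_nonneg (by linarith) (Real.log_nonneg hn1)
  have hδL : 0 ≤ δ * L := by positivity
  have hδL1 : δ * L ≤ L := mul_le_of_le_one_left hL0 hδ1.le
  have hδδL0 : 0 ≤ δ * (δ * L) := by positivity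
  have hδδL : δ * (δ * L) ≤ δ * L := mul_le_of_le_one_left hδL hδ1.le
  have hlogM : Real.log (2 * M) * n ≤ |Real.log (2 * M)| * n := by
    gcongr
    exact le_abs_self _
  have hlogM0 : 0 ≤ |Real.log (2 * M)| * n := by positivity
  have hx2 : Real.exp (δ / 3) - 1 ≤ δ / 3 + (δ / 3) ^ 2 := by
    have := abs_le.1 (Real.abs_exp_sub_one_sub_id_le (x := δ / 3)
      (by rw [abs_of_pos] <;> linarith))
    linarith [this.2]
  have hx3 : (1 / 2 + δ) * L * (Real.exp (δ / 3) - 1) - (1 / 2 + 2 * δ) * L * (δ / 3) ≤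
      -(δ ^ 2 / 8 * L) := by
    have : (1 / 2 + δ) * L * (Real.exp (δ / 3) - 1) ≤
        (1 / 2 + δ) * L * (δ / 3 + (δ / 3) ^ 2) := by gcongr
    have : δ * (δ * (δ * L)) ≤ δ * (δ * L) := mul_le_mul_of_nonneg_left hδδL hδ.le
    linarith
  have hdist : ∀ s : ℝ, 0 < s → (n : ℝ) ^ (-s) ≤ 4 := fun s hs =>
    (Real.rpow_le_one_of_one_le_of_nonpos hn1 (by linarith)).trans (by norm_num)
  have hmain := PoissonCovering.measure_compl_le_of_isPoissonProcess hpack hM hvol hX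
    (η := (n : ℝ) ^ (-(1 / 2 + δ / 4))) (τ := (n : ℝ) ^ (-2 : ℝ)) (κ := Real.exp (-K))
    (γ := δ / 6) (a := c * L) (B := 3 * ((1 / 2 + δ) * L)) (K := K) (x := δ / 3)
    (D := (1 / 2 + 2 * δ) * L) (ℓ := (1 / 2 + δ) * L)
    (intensity_mul_unitBallVolume (by positivity))
    (by positivity) (hdist _ (by positivity)) (by positivity) (hdist _ (by norm_num))
    (Real.exp_pos _).le hcres (by positivity) (by linarith) (by positivity) (by positivity)
    hK0.le (by positivity) (by positivity)
    (hx3.trans (neg_nonpos.2 (by positivity)))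
  set E := Real.exp (C * n - δ ^ 2 / 8 * L) with hE
  rw [div_rpow_neg_pow_eq_exp hM hn, div_rpow_neg_pow_eq_exp hM hn, ← hL,
    ← Real.exp_add, ← Real.exp_add, ← Real.exp_add, ← Real.exp_add] at hmain
  have t1 : Real.exp (Real.log (2 * M) * n + (1 / 2 + δ / 4) * L +
      ((1 / 2 + δ) * L * (δ / 6 - 1) - c * L * Real.log (δ / 6))) ≤ E := by
    apply Real.exp_le_exp.2
    rw [show c * L * Real.log (δ / 6) = c * Real.log (δ / 6) * L by ring, hclog]
    simp only [C]
    linarith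
  have t2 : Real.exp (Real.log (2 * M) * n + (1 / 2 + δ / 4) * L +
      ((1 / 2 + δ) * L * (Real.exp 1 - 1) - 3 * ((1 / 2 + δ) * L))) ≤ E := by
    apply Real.exp_le_exp.2
    have he : (1 / 2 + δ) * L * (Real.exp 1 - 1) ≤ (1 / 2 + δ) * L * 2 := by
      gcongr
      linarith [Real.exp_one_lt_d9]
    simp only [C]
    linarith
  have t3 : Real.exp (Real.log (2 * M) * n + (1 / 2 + δ / 4) * L +
      (Real.log (2 * M) * n + 2 * L +
        ((1 / 2 + δ) * L * Real.exp (-K) * (Real.exp K - 1) - c * L * K))) ≤ E := by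
    apply Real.exp_le_exp.2
    have he : (1 / 2 + δ) * L * Real.exp (-K) * (Real.exp K - 1) ≤ (1 / 2 + δ) * L := by
      rw [mul_assoc, mul_sub, ← Real.exp_add, neg_add_cancel, Real.exp_zero, mul_one]
      refine mul_le_of_le_one_right (by positivity) ?_
      linarith [Real.exp_pos (-K)]
    rw [show c * L * K = c * K * L by ring, hcK]
    simp only [C]
    linarith
  have t4 : Real.exp ((1 / 2 + δ) * L * (Real.exp (δ / 3) - 1) -
      (1 / 2 + 2 * δ) * L * (δ / 3)) ≤ E := by
    apply Real.exp_le_exp.2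
    simp only [C]
    linarith
  have hsum : 3 * ((1 / 2 + δ) * L) + c * L ≤ (ξ + 10 * δ) * L := by
    rw [← mul_assoc, ← add_mul]
    exact mul_le_mul_of_nonneg_right (by linarith) hL0
  refine (measure_mono (Set.compl_subset_compl.2 ?_)).trans (hmain.trans ?_)
  · rintro ω ⟨h1, h2, h3⟩
    exact ⟨h1, h2, h3.trans (ENNReal.ofReal_le_ofReal hsum)⟩
  · have hE0 : 0 ≤ E := (Real.exp_pos _).le
    calc _ ≤ ENNReal.ofReal E + ENNReal.ofReal E + 2 * ENNReal.ofReal E + ENNReal.ofReal E := by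
          gcongr
      _ = ENNReal.ofReal (5 * E) := by
          rw [ENNReal.ofReal_mul (by norm_num), ENNReal.ofReal_ofNat]
          ring
      _ ≤ ENNReal.ofReal ε := ENNReal.ofReal_le_ofReal (by linarith)
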